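/- **Setting.** Consider a directed graph with finitely many arcs ($A$ of them), origin-destination (OD) pairs $k$ with demand $q_k$ and longest acceptable travel time $\tau_k$, and finitely many directed paths $r=1,\dots,N$, each of which connects one OD pair $k(r)$. Let $\Pi$ be the OD-path incidence matrix ($\pi_{kr}=1$ if path $r$ connects the pair $k$, else $0$), $\Delta$ the arc-path incidence matrix ($\delta_{ar}=1$ if arc $a$ is on path $r$, else $0$), and $D=\{f\in\mathbb R^N_+:\Pi f=q\}$. Let $N_D(f)=\{w:\langle w,g-f\rangle\le 0\ \forall g\in D\}$ for $f\in D$ and $N_D(f)=\emptyset$ for $f\notin D$. Let $T(v,\xi)\in\mathbb R^A$ be the vector of arc travel times for the arc flow $v\in\mathbb R^A$ and the random factors $\xi\in\mathbb R^m$, and $C(f,\xi)=\Delta^\top T(\Delta f,\xi)$ the vector of path travel times. Fix $t>0$, real weights $\theta_0,\theta_1,\theta_2$ and $d\in\mathbb R^N$, and let $$\hat u_r(f,C(f,\xi),t)=\theta_0d_r+\theta_1C_r(f,\xi)+\theta_2\,h(C_r(f,\xi)-\tau_{k(r)},t),\qquad r=1,\dots,N,$$ where $h(z,t)=z$ for $z>t$,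 $h(z,t)=\frac{1}{4t}(z+t)^2$ for $-t\le z\le t$, and $h(z,t)=0$ for $z<-t$. For a probability measure $Q$ on $\mathbb R^m$ let $\hat\varphi_t(f,Q)=E_Q[\hat u(f,C(f,\xi),t)]$, and let $F_t(Q)$ be the set of those $f$ for which this expectation exists and $0\in\hat\varphi_t(f,Q)+N_D(f)$. For a set-valued map $\Gamma$ and $u\in\Gamma(z)$, the proto-derivative is $$\Gamma'_{z,u}(d)=\limsup_{\varepsilon\downarrow0,\ d'\to d}\frac{\Gamma(z+\varepsilon d')-u}{\varepsilon}\qquad\text{(outer limit of sets)}.$$ The generalized influence function $\mathrm{GIF}(\tilde\xi;F_t(\cdot),P,f^*)$ is the proto-derivative of $\varepsilon\mapsto F_t((1-\varepsilon)P+\varepsilon\delta_{\tilde\xi})$ at $0$ for $f^*\in F_t(P)$, in the direction $1$, and $\|\mathrm{GIF}\|$ is the least $\nu\in[0,\infty]$ with $\|\eta\|\le\nu$ for all $\eta\in\mathrm{GIF}$. A set-valued map $\Upsilon$ on $\mathbb R^N$ is strongly metrically regular at $\bar f$ for $\bar g$ with modulus $\gamma>0$ if $d(f,\Upsilon^{-1}(g))\le\gamma\,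 d(g,\Upsilon(f))$ for all $(f,g)$ in a neighbourhood of $(\bar f,\bar g)$ (with $d(\cdot,\emptyset)=\infty$) and there are neighbourhoods $V$ of $\bar f$ and $W$ of $\bar g$ such that for every $g\in W$ the set $V\cap\Upsilon^{-1}(g)$ has exactly one element. **Assumptions.** $P$ is a probability measure on $\mathbb R^m$ concentrated on a compact set $\Xi$. There is a convex compact set $\mathbb F_t\subset\mathbb R^N$ that contains $F_t(P)+b\mathcal B$ for some $b>0$, where $\mathcal B$ is the unit ball. Let $\mathbb V_t=\Delta(\mathbb F_t)$. For every $v$ the map $T(v,\cdot)$ is measurable on $\mathbb R^m$, and for every $\xi\in\mathbb R^m$ the map $T(\cdot,\xi)$ is continuous. For every $\xi\in\Xi$, (a) $T(\cdot,\xi)$ is continuously differentiable; (b) $\sup_{v\in\mathbb V_t}\|T(v,\xi)\|\le\Phi_1(\xi)$; (c) $\|T(v,\xi)-T(v',\xi)\|\le\Phi_2(\xi)\|v-v'\|$ for all $v,v'\in\mathbb V_t$; here $\Phi_1$ and $\Phi_2>0$ are $P$-integrable. **Theorem.** Let $f^*_t\in F_t(P)$ and $\hat u^*=-\hat\varphi_t(f^*_t,P)$.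 Suppose that the linearized generalized equation $$0\in E_P\big[\nabla_f\hat u(f^*_t,C(f^*_t,\xi),t)\big]f+(N_D)'_{f^*_t,\hat u^*}(f)$$ has the unique solution $f=0$. Then: (i) $\mathrm{GIF}(\tilde\xi;F_t(\cdot),P,f^*_t)$ is bounded for every $\tilde\xi\in\mathbb R^m$. (ii) If, in addition, $f\mapsto\hat\varphi_t(f,P)+N_D(f)$ (taken to be empty where the expectation does not exist) is strongly metrically regular at $f^*_t$ for $0$ with modulus $\gamma$, then $$\sup_{\tilde\xi\in\mathbb R^m}\big\|\mathrm{GIF}(\tilde\xi;F_t(\cdot),P,f^*_t)\big\|\le\gamma\sup_{f\in\mathbb F_t,\ \tilde\xi\in\mathbb R^m}\big\|\hat\varphi_t(f,P)-\hat u(f,C(f,\tilde\xi),t)\big\|,$$ where both sides may be $+\infty$. -/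

import Mathlib

open MeasureTheory Filter Topology
open scoped ENNReal Matrix

noncomputable section

/-! ## Set-valued analysis -/

section SetValued

variable {X Y : Type*} [NormedAddCommGroup X] [NormedSpace ℝ X]
  [NormedAddCommGroup Y] [NormedSpace ℝ Y]

/-- The proto-derivative of a set-valued map `Γ` at `z` for `u`, through its limit formula
`Γ'_{z,u}(d) = limsup_{ε ↓ 0, d' → d} (Γ (z + ε d') - u) / ε`, where `limsup` is the
(Painlevé-Kuratowski) outer limit of sets: the set of all limits of sequences
`ηₙ ∈ (Γ (z + εₙ dₙ) - u) / εₙ` with `εₙ ↓ 0` and `dₙ → d`. -/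
def protoDeriv (Γ : X → Set Y) (z : X) (u : Y) (d : X) : Set Y :=
  {η | ∃ (ε : ℕ → ℝ) (d' : ℕ → X) (η' : ℕ → Y),
    (∀ n, 0 < ε n) ∧ Tendsto ε atTop (𝓝 0) ∧ Tendsto d' atTop (𝓝 d) ∧
    Tendsto η' atTop (𝓝 η) ∧ ∀ n, u + ε n • η' n ∈ Γ (z + ε n • d' n)}

/-- The inverse of a set-valued map. -/
def setInverse (Γ : X → Set Y) (y : Y) : Set X := {x | y ∈ Γ x}

/-- `Γ` is metrically regular at `x₀` for `y₀` with regularity modulus `α`. Distances are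
extended distances, so the distance to the empty set is `∞`. -/
def MetricallyRegular (Γ : X → Set Y) (x₀ : X) (y₀ : Y) (α : ℝ) : Prop :=
  0 < α ∧ ∃ V ∈ 𝓝 x₀, ∃ W ∈ 𝓝 y₀, ∀ x ∈ V, ∀ y ∈ W,
    Metric.infEDist x (setInverse Γ y) ≤ ENNReal.ofReal α * Metric.infEDist y (Γ x)

/-- `Γ` is strongly metrically regular at `x₀` for `y₀` with regularity modulus `α`. -/
def StronglyMetricallyRegular (Γ : X → Set Y) (x₀ : X) (y₀ : Y) (α : ℝ) : Prop :=
  MetricallyRegular Γ x₀ y₀ α ∧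
    ∃ V ∈ 𝓝 x₀, ∃ W ∈ 𝓝 y₀, ∀ y ∈ W, ∃! x, x ∈ V ∩ setInverse Γ y

end SetValued

/-- The normal cone to a set `D` at `f` (empty when `f ∉ D`). -/
def normalCone {E : Type*} [NormedAddCommGroup E] [InnerProductSpace ℝ E]
    (D : Set E) (f : E) : Set E :=
  {w | f ∈ D ∧ ∀ g ∈ D, inner ℝ w (g - f) ≤ 0}

/-! ## The transportation network -/

/-- The list `l` of arcs is a directed walk from `x` to `y`, in the directed graph whose arcs run
from `tail a` to `head a`. -/
def IsDirectedWalk {Node Arc : Type*} (tail head : Arc → Node) : Node → List Arc → Node → Prop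
  | x, [], y => x = y
  | x, a :: l, y => tail a = x ∧ IsDirectedWalk tail head (head a) l y

/-- A directed graph with origin-destination (OD) pairs and, for each of them, a family of directed
paths that connect it (the paths `r` with `od r = k` connect the pair `k`). -/
structure TransportNetwork (Node Arc OD Path : Type*) where
  tail : Arc → Node
  head : Arc → Node
  origin : OD → Node
  destination : OD → Node
  od : Path → OD
  arcs : Path → List Arc
  connects : ∀ r, IsDirectedWalk tail head (origin (od r)) (arcs r) (destination (od r))

namespace TransportNetwork

variable {Node Arc OD Path : Type*} (G : TransportNetwork Node Arc OD Path)

open Classical in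
/-- The OD-path incidence matrix `Π`. -/
def odIncidence : Matrix OD Path ℝ := Matrix.of fun k r => if G.od r = k then 1 else 0

open Classical in
/-- The arc-path incidence matrix `Δ`. -/
def arcIncidence : Matrix Arc Path ℝ := Matrix.of fun a r => if a ∈ G.arcs r then 1 else 0

/-- The set `D` of feasible path flows for the demand vector `q`. -/
def feasible [Fintype Path] (q : OD → ℝ) : Set (EuclideanSpace ℝ Path) :=
  {f | (∀ r, 0 ≤ f r) ∧ G.odIncidence *ᵥ f.ofLp = q}

/-- The arc flow `v = Δ f` of a path flow `f`. -/
def arcFlow [Fintype Path] (f : EuclideanSpace ℝ Path) : EuclideanSpace ℝ Arc :=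
  WithLp.toLp 2 (G.arcIncidence *ᵥ f.ofLp)

end TransportNetwork

/-! ## The modified late arrival penalised user equilibrium (MLAPUE) -/

/-- The smoothed lateness penalty `h(z, t)`, an approximation of `max z 0` for small `t > 0`. -/
def latePenalty (z t : ℝ) : ℝ :=
  if t < z then z else if -t ≤ z then (z ^ 2 + 2 * z * t + t ^ 2) / (4 * t) else 0

/-- The data of the model: a network, the demand `q`, the weights `θ₀`, `θ₁`, `θ₂`, the composite
attributes `attr` of the paths (such as distance), the longest acceptable travel times `τ` of the
OD pairs, and the vector `T v ξ` of arc travel times for the arc flow `v` and the value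
`ξ ∈ ℝᵐ` of the random factors. -/
structure MLAPUEModel (Node Arc OD Path : Type*) (m : ℕ) where
  net : TransportNetwork Node Arc OD Path
  q : OD → ℝ
  θ₀ : ℝ
  θ₁ : ℝ
  θ₂ : ℝ
  attr : Path → ℝ
  τ : OD → ℝ
  T : EuclideanSpace ℝ Arc → EuclideanSpace ℝ (Fin m) → EuclideanSpace ℝ Arc

namespace MLAPUEModel

variable {Node Arc OD Path : Type*} [Fintype Arc] [Fintype Path] {m : ℕ}
  (M : MLAPUEModel Node Arc OD Path m)

/-- The set `D` of feasible path flows. -/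
def D : Set (EuclideanSpace ℝ Path) := M.net.feasible M.q

/-- The vector of path travel times `C(f, ξ) = Δᵀ T(Δ f, ξ)`. -/
def pathTime (f : EuclideanSpace ℝ Path) (ξ : EuclideanSpace ℝ (Fin m)) :
    EuclideanSpace ℝ Path :=
  WithLp.toLp 2 (M.net.arcIncidenceᵀ *ᵥ (M.T (M.net.arcFlow f) ξ).ofLp)

/-- The vector of path disutilities `û(f, C(f, ξ), t)`, with components
`θ₀ d_r + θ₁ C_r(f, ξ) + θ₂ h(C_r(f, ξ) - τ_k, t)`, where `k` is the OD pair of the path `r`. -/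
def disutility (t : ℝ) (f : EuclideanSpace ℝ Path) (ξ : EuclideanSpace ℝ (Fin m)) :
    EuclideanSpace ℝ Path :=
  WithLp.toLp 2 fun r => M.θ₀ * M.attr r + M.θ₁ * M.pathTime f ξ r +
    M.θ₂ * latePenalty (M.pathTime f ξ r - M.τ (M.net.od r)) t

/-- The expected disutility `φ̂_t(f, Q) = E_Q[û(f, C(f, ξ), t)]`. -/
def expDisutility (t : ℝ) (f : EuclideanSpace ℝ Path) (Q : Measure (EuclideanSpace ℝ (Fin m))) :
    EuclideanSpace ℝ Path :=
  ∫ ξ, M.disutility t f ξ ∂Q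

/-- The expected Jacobian `E_Q[∇_f û(f, C(f, ξ), t)]`. -/
def expJacobian (t : ℝ) (f : EuclideanSpace ℝ Path) (Q : Measure (EuclideanSpace ℝ (Fin m))) :
    EuclideanSpace ℝ Path →L[ℝ] EuclideanSpace ℝ Path :=
  ∫ ξ, fderiv ℝ (fun g => M.disutility t g ξ) f ∂Q

/-- The set-valued map `f ↦ φ̂_t(f, Q) + N_D(f)` (empty where the expectation does not exist). -/
def equilibriumMap (t : ℝ) (Q : Measure (EuclideanSpace ℝ (Fin m)))
    (f : EuclideanSpace ℝ Path) : Set (EuclideanSpace ℝ Path) :=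
  {y | Integrable (M.disutility t f) Q ∧
    ∃ w ∈ normalCone M.D f, y = M.expDisutility t f Q + w}

/-- The set `F_t(Q)` of modified equilibria: the solutions `f` of
`0 ∈ E_Q[û(f, C(f, ξ), t)] + N_D(f)`. -/
def equilibria (t : ℝ) (Q : Measure (EuclideanSpace ℝ (Fin m))) :
    Set (EuclideanSpace ℝ Path) :=
  {f | 0 ∈ M.equilibriumMap t Q f}

/-- The mixture `(1 - ε) P + ε δ_ξ'` (a probability measure for `0 ≤ ε ≤ 1`; only small `ε > 0`
matter below). -/
def contaminated (P : Measure (EuclideanSpace ℝ (Fin m))) (ξ' : EuclideanSpace ℝ (Fin m))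
    (ε : ℝ) : Measure (EuclideanSpace ℝ (Fin m)) :=
  ENNReal.ofReal (1 - ε) • P + ENNReal.ofReal ε • Measure.dirac ξ'

/-- The generalized influence function `GIF(ξ'; F_t(·), P, f)`: the proto-derivative at `0` for
`f`, in the direction `1`, of `ε ↦ F_t((1 - ε) P + ε δ_ξ')`. -/
def GIF (t : ℝ) (P : Measure (EuclideanSpace ℝ (Fin m))) (f : EuclideanSpace ℝ Path)
    (ξ' : EuclideanSpace ℝ (Fin m)) : Set (EuclideanSpace ℝ Path) :=
  protoDeriv (fun ε : ℝ => M.equilibria t (contaminated P ξ' ε)) 0 f 1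

/-- The norm of the generalized influence function: the least `ν` in `[0, ∞]` that bounds the norms
of its elements. -/
def normGIF (t : ℝ) (P : Measure (EuclideanSpace ℝ (Fin m))) (f : EuclideanSpace ℝ Path)
    (ξ' : EuclideanSpace ℝ (Fin m)) : ℝ≥0∞ :=
  sInf {ν | ∀ η ∈ M.GIF t P f ξ', ‖η‖ₑ ≤ ν}

end MLAPUEModel

end

/-! Write `Γ = φ̂_t(·, P) + N_D`, so that the equilibria for `P` are the zeros of `Γ`. An equilibrium
`g` for the contaminated measure `(1 - s) P + s δ_ξ'` satisfies
`s (φ̂_t(g, P) - û(g, ξ')) ∈ Γ(g)`. Dividing by `s ↓ 0` shows that every element `η` of the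
generalized influence function solves `p ∈ Γ'_{f,0}(η)` with the fixed right-hand side
`p = φ̂_t(f, P) - û(f, ξ')`. Both claims are now about the inverse of `Γ'_{f,0}`.

* The graph of `Γ'_{f,0}` is a closed cone. If solutions `η` of `p ∈ Γ'_{f,0}(η)` were unbounded,
  a limit of the directions `η / ‖η‖` would be a unit solution of `0 ∈ Γ'_{f,0}(η)`. By dominated
  convergence `φ̂_t(·, P)` is differentiable at `f` with derivative the expected Jacobian, so this
  would be a nonzero solution of the linearized generalized equation.
* Strong metric regularity isolates `f` as a zero of `Γ` and gives `‖x - f‖ ≤ γ ‖y‖` for `y ∈ Γ(x)`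
  and `x` near `f`. The estimate passes to difference quotients, hence `‖η‖ ≤ γ ‖p‖`.
-/

section ProtoDeriv

variable {X Y : Type*} [NormedAddCommGroup X] [NormedSpace ℝ X]
  [NormedAddCommGroup Y] [NormedSpace ℝ Y] {Γ Γ' : X → Set Y} {z d : X} {u η : Y}

theorem mem_protoDeriv_iff_frequently : η ∈ protoDeriv Γ z u d ↔
    ∃ᶠ p in 𝓝[>] (0 : ℝ) ×ˢ 𝓝 (d, η), u + p.1 • p.2.2 ∈ Γ (z + p.1 • p.2.1) := by
  constructor
  · rintro ⟨ε, d', η', hε, hε0, hd, hη, hmem⟩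
    have hε' : Tendsto ε atTop (𝓝[>] 0) :=
      tendsto_nhdsWithin_iff.2 ⟨hε0, Eventually.of_forall hε⟩
    exact (hε'.prodMk (hd.prodMk_nhds hη)).frequently (Frequently.of_forall hmem)
  · intro h
    have hpos : ∀ᶠ p in 𝓝[>] (0 : ℝ) ×ˢ 𝓝 (d, η), 0 < p.1 :=
      tendsto_fst.eventually self_mem_nhdsWithin
    obtain ⟨p, hp, hmem⟩ := exists_seq_forall_of_frequently (h.and_eventually hpos)
    have hp₂ : Tendsto (fun n => (p n).2) atTop (𝓝 (d, η)) := tendsto_snd.comp hp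
    exact ⟨fun n => (p n).1, fun n => (p n).2.1, fun n => (p n).2.2, fun n => (hmem n).2,
      (tendsto_fst.comp hp).mono_right nhdsWithin_le_nhds, hp₂.fst_nhds, hp₂.snd_nhds,
      fun n => (hmem n).1⟩

theorem protoDeriv_mono (h : ∀ x, Γ x ⊆ Γ' x) : protoDeriv Γ z u d ⊆ protoDeriv Γ' z u d :=
  fun _ ⟨ε, d', η', hε, hε0, hd, hη, hmem⟩ =>
    ⟨ε, d', η', hε, hε0, hd, hη, fun n => h _ (hmem n)⟩

theorem smul_mem_protoDeriv (h : η ∈ protoDeriv Γ z u d) {c : ℝ} (hc : 0 < c) :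
    c • η ∈ protoDeriv Γ z u (c • d) := by
  obtain ⟨ε, d', η', hε, hε0, hd, hη, hmem⟩ := h
  refine ⟨fun n => ε n / c, fun n => c • d' n, fun n => c • η' n, fun n => div_pos (hε n) hc,
    by simpa using hε0.div_const c, hd.const_smul c, hη.const_smul c, fun n => ?_⟩
  simpa only [smul_smul, div_mul_cancel₀ _ hc.ne'] using hmem n

theorem isClosed_graph_protoDeriv (Γ : X → Set Y) (z : X) (u : Y) :
    IsClosed {q : X × Y | q.2 ∈ protoDeriv Γ z u q.1} := by
  rw [← isOpen_compl_iff, isOpen_iff_mem_nhds]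
  intro q hq
  rw [Set.mem_compl_iff, Set.mem_ofPred_eq, mem_protoDeriv_iff_frequently, not_frequently,
    eventually_prod_iff] at hq
  obtain ⟨A, hA, B, hB, hAB⟩ := hq
  filter_upwards [eventually_eventually_nhds.2 hB] with q' hq'
  rw [Set.mem_compl_iff, Set.mem_ofPred_eq, mem_protoDeriv_iff_frequently, not_frequently]
  exact eventually_prod_iff.2 ⟨A, hA, B, hq', hAB⟩

/-- The sum rule for the proto-derivative of `φ + Γ`, which is encoded as the set-valued map
`x ↦ {y | y - φ x ∈ Γ x}`. -/
theorem sub_mem_protoDeriv_of_hasFDerivAt {φ : X → Y} {J : X →L[ℝ] Y} (hφ : HasFDerivAt φ J z)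
    (h : η ∈ protoDeriv (fun x => {y | y - φ x ∈ Γ x}) z u d) :
    η - J d ∈ protoDeriv Γ z (u - φ z) d := by
  obtain ⟨ε, d', η', hε, hε0, hd, hη, hmem⟩ := h
  have hquot : Tendsto (fun n => (ε n)⁻¹ • (φ (z + ε n • d' n) - φ z)) atTop (𝓝 (J d)) := by
    refine hφ.hasFDerivWithinAt.lim (s := Set.univ) (by simpa using hε0.smul hd) (by simp)
      (hd.congr fun n => ?_)
    rw [inv_smul_smul₀ (hε n).ne']
  refine ⟨ε, d', _, hε, hε0, hd, hη.sub hquot, fun n => ?_⟩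
  have hn : u - φ z + ε n • (η' n - (ε n)⁻¹ • (φ (z + ε n • d' n) - φ z)) =
      u + ε n • η' n - φ (z + ε n • d' n) := by
    rw [smul_sub, smul_inv_smul₀ (hε n).ne']
    abel
  simpa only [hn] using! hmem n

/-- Along solutions `x` for parameters `s ↓ 0`, the residual `r x` itself is a difference quotient
of `Γ` at `u` with step `s`. -/
theorem mem_protoDeriv_of_smul_residual {S : ℝ → Set X} {r : X → Y} (hr : ContinuousAt r z)
    (hS : ∀ᶠ s in 𝓝[>] 0, ∀ x ∈ S s, u + s • r x ∈ Γ x) (hd : d ∈ protoDeriv S 0 z 1) :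
    r z ∈ protoDeriv Γ z u d := by
  rw [mem_protoDeriv_iff_frequently] at hd ⊢
  have hε : Tendsto (fun p : ℝ × ℝ × X => p.1) (𝓝[>] 0 ×ˢ 𝓝 (1, d)) (𝓝 0) :=
    tendsto_fst.mono_right nhdsWithin_le_nhds
  have hc : Tendsto (fun p : ℝ × ℝ × X => p.2.1) (𝓝[>] 0 ×ˢ 𝓝 (1, d)) (𝓝 1) :=
    tendsto_snd.fst_nhds
  have hd' : Tendsto (fun p : ℝ × ℝ × X => p.2.2) (𝓝[>] 0 ×ˢ 𝓝 (1, d)) (𝓝 d) :=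
    tendsto_snd.snd_nhds
  have hs : Tendsto (fun p : ℝ × ℝ × X => p.1 * p.2.1) (𝓝[>] 0 ×ˢ 𝓝 (1, d)) (𝓝[>] 0) := by
    refine tendsto_nhdsWithin_iff.2 ⟨by simpa using hε.mul hc, ?_⟩
    filter_upwards [tendsto_fst.eventually self_mem_nhdsWithin, hc.eventually_const_lt one_pos]
      with p h₁ h₂ using mul_pos h₁ h₂
  have hx : Tendsto (fun p : ℝ × ℝ × X => z + p.1 • p.2.2) (𝓝[>] 0 ×ˢ 𝓝 (1, d)) (𝓝 z) := by
    simpa using (hε.smul hd').const_add z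
  have hη : Tendsto (fun p : ℝ × ℝ × X => p.2.1 • r (z + p.1 • p.2.2)) (𝓝[>] 0 ×ˢ 𝓝 (1, d))
      (𝓝 (r z)) := by
    simpa using hc.smul (hr.tendsto.comp hx)
  refine (tendsto_fst.prodMk (hd'.prodMk_nhds hη)).frequently
    ((hd.and_eventually (hs.eventually hS)).mono fun p hp => ?_)
  rw [smul_smul]
  exact hp.2 _ (by simpa only [zero_add, smul_eq_mul] using hp.1)

theorem isBounded_setInverse_protoDeriv [FiniteDimensional ℝ X]
    (h : setInverse (protoDeriv Γ z u) 0 ⊆ {0}) (p : Y) :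
    Bornology.IsBounded (setInverse (protoDeriv Γ z u) p) := by
  by_contra hunbdd
  have : ProperSpace X := FiniteDimensional.proper_real X
  have : (Bornology.cobounded X).IsCountablyGenerated := by
    rw [← comap_norm_atTop]
    infer_instance
  have hfreq : ∃ᶠ g in Bornology.cobounded X, p ∈ protoDeriv Γ z u g ∧ g ≠ 0 :=
    Frequently.and_eventually (fun hc => hunbdd (Bornology.isBounded_def.2 hc))
      (Bornology.eventually_ne_cobounded 0)
  obtain ⟨g, hg, hmem⟩ := exists_seq_forall_of_frequently hfreq
  have hinv : Tendsto (fun n => ‖g n‖⁻¹) atTop (𝓝 0) :=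
    tendsto_inv_atTop_zero.comp (tendsto_norm_cobounded_atTop.comp hg)
  obtain ⟨e, he, φ, hφ, hlim⟩ := (isCompact_sphere (0 : X) 1).tendsto_subseq
    (x := fun n => ‖g n‖⁻¹ • g n) fun n => by simp [norm_smul, (hmem n).2]
  have hzero : Tendsto (fun n => ‖g (φ n)‖⁻¹ • p) atTop (𝓝 0) := by
    simpa using (hinv.comp hφ.tendsto_atTop).smul_const p
  have hmem₀ : (0 : Y) ∈ protoDeriv Γ z u e :=
    (isClosed_graph_protoDeriv Γ z u).mem_of_tendsto (hlim.prodMk_nhds hzero)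
      (Eventually.of_forall fun n =>
        smul_mem_protoDeriv (hmem (φ n)).1 (inv_pos.2 (norm_pos_iff.2 (hmem (φ n)).2)))
  have he₀ : e = 0 := h hmem₀
  simp [he₀] at he

theorem enorm_le_of_mem_protoDeriv {α : ℝ≥0∞} (hα : α ≠ ∞)
    (hΓ : ∀ᶠ x in 𝓝 z, ∀ y ∈ Γ x, ‖x - z‖ₑ ≤ α * ‖y - u‖ₑ) (h : η ∈ protoDeriv Γ z u d) :
    ‖d‖ₑ ≤ α * ‖η‖ₑ := by
  obtain ⟨ε, d', η', hε, hε0, hd, hη, hmem⟩ := h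
  have hx : Tendsto (fun n => z + ε n • d' n) atTop (𝓝 z) := by
    simpa using (hε0.smul hd).const_add z
  refine le_of_tendsto_of_tendsto hd.enorm (ENNReal.Tendsto.const_mul hη.enorm (.inr hα)) ?_
  filter_upwards [hx.eventually hΓ] with n hn
  have h := hn _ (hmem n)
  rw [add_sub_cancel_left, add_sub_cancel_left, enorm_smul, enorm_smul, mul_left_comm] at h
  exact (ENNReal.mul_le_mul_iff_right (enorm_ne_zero.2 (hε n).ne') enorm_ne_top).1 h

end ProtoDeriv

theorem eventually_edist_le_infEDist {X : Type*} [PseudoEMetricSpace X] {x₀ : X} {s V : Set X}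
    (hV : V ∈ 𝓝 x₀) (hs : V ∩ s ⊆ {x₀}) :
    ∀ᶠ x in 𝓝 x₀, edist x x₀ ≤ Metric.infEDist x s := by
  obtain ⟨r, hr, hball⟩ := EMetric.mem_nhds_iff.1 hV
  filter_upwards [Metric.eball_mem_nhds x₀ (ENNReal.half_pos hr.ne')] with x hx
  refine Metric.le_infEDist.2 fun x' hx' => le_of_not_gt fun hlt => ?_
  have hx'V : x' ∈ V := hball <| calc
    edist x' x₀ ≤ edist x x' + edist x x₀ := edist_triangle_left ..
    _ < r / 2 + r / 2 := ENNReal.add_lt_add (hlt.trans hx) hx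
    _ = r := ENNReal.add_halves r
  have hx'₀ : x' = x₀ := hs ⟨hx'V, hx'⟩
  exact hlt.ne (by rw [hx'₀])

theorem StronglyMetricallyRegular.eventually_enorm_sub_le {X Y : Type*} [NormedAddCommGroup X]
    [NormedAddCommGroup Y] {Γ : X → Set Y} {x₀ : X} {y₀ : Y} {α : ℝ}
    (h : StronglyMetricallyRegular Γ x₀ y₀ α) (h₀ : y₀ ∈ Γ x₀) :
    ∀ᶠ x in 𝓝 x₀, ∀ y ∈ Γ x, ‖x - x₀‖ₑ ≤ ENNReal.ofReal α * ‖y - y₀‖ₑ := by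
  obtain ⟨⟨-, V, hV, W, hW, hreg⟩, V', hV', W', hW', huniq⟩ := h
  have hisolated : V' ∩ setInverse Γ y₀ ⊆ {x₀} := fun x hx =>
    (huniq y₀ (mem_of_mem_nhds hW')).unique hx ⟨mem_of_mem_nhds hV', h₀⟩
  filter_upwards [hV, eventually_edist_le_infEDist hV' hisolated] with x hxV hx y hy
  calc ‖x - x₀‖ₑ = edist x x₀ := (edist_eq_enorm_sub ..).symm
    _ ≤ Metric.infEDist x (setInverse Γ y₀) := hx
    _ ≤ ENNReal.ofReal α * Metric.infEDist y₀ (Γ x) := hreg x hxV y₀ (mem_of_mem_nhds hW)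
    _ ≤ ENNReal.ofReal α * edist y₀ y := by gcongr; exact Metric.infEDist_le_edist_of_mem hy
    _ = ENNReal.ofReal α * ‖y - y₀‖ₑ := by rw [edist_comm, edist_eq_enorm_sub]

section Integral

variable {Ω E F : Type*} [MeasurableSpace Ω] {μ : Measure Ω} [NormedAddCommGroup E]
  [NormedAddCommGroup F]

theorem aestronglyMeasurable_clm_of_apply {𝕜 : Type*} [NontriviallyNormedField 𝕜]
    [CompleteSpace 𝕜] [NormedSpace 𝕜 E] [FiniteDimensional 𝕜 E] [NormedSpace 𝕜 F]
    {L : Ω → E →L[𝕜] F} (h : ∀ v, AEStronglyMeasurable (fun ω => L ω v) μ) :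
    AEStronglyMeasurable L μ := by
  let b := Module.finBasis 𝕜 E
  let coord i : E →L[𝕜] 𝕜 := LinearMap.toContinuousLinearMap (b.coord i)
  have hsum : L = fun ω => ∑ i, ContinuousLinearMap.smulRightL 𝕜 E F (coord i) (L ω (b i)) := by
    ext ω v
    conv_lhs => rw [← b.sum_repr v, map_sum]
    simp [coord]
  rw [hsum]
  exact Finset.aestronglyMeasurable_fun_sum _ fun i _ =>
    (ContinuousLinearMap.smulRightL 𝕜 E F (coord i)).continuous.comp_aestronglyMeasurable
      (h (b i))

variable [NormedSpace ℝ E] [FiniteDimensional ℝ E] [NormedSpace ℝ F] {u : E → Ω → F} {x : E}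

theorem aestronglyMeasurable_fderiv_of_ae_differentiableAt
    (hmeas : ∀ y, AEStronglyMeasurable (u y) μ)
    (hdiff : ∀ᵐ ω ∂μ, DifferentiableAt ℝ (fun y => u y ω) x) :
    AEStronglyMeasurable (fun ω => fderiv ℝ (fun y => u y ω) x) μ := by
  refine aestronglyMeasurable_clm_of_apply fun v => ?_
  refine aestronglyMeasurable_of_tendsto_ae (u := atTop)
    (f := fun (n : ℕ) ω => (n : ℝ) • (u (x + (n : ℝ)⁻¹ • v) ω - u x ω))
    (fun n => ((hmeas _).sub (hmeas _)).const_smul _) ?_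
  filter_upwards [hdiff] with ω hω
  exact (hω.hasFDerivAt.lim_real v).comp tendsto_natCast_atTop_atTop

theorem hasFDerivAt_integral_fderiv_of_lip {s : Set E} {bound : Ω → ℝ} (hs : s ∈ 𝓝 x)
    (hmeas : ∀ y, AEStronglyMeasurable (u y) μ) (hint : Integrable (u x) μ)
    (hlip : ∀ᵐ ω ∂μ, LipschitzOnWith (Real.nnabs (bound ω)) (fun y => u y ω) s)
    (hbound : Integrable bound μ) (hdiff : ∀ᵐ ω ∂μ, DifferentiableAt ℝ (fun y => u y ω) x) :
    HasFDerivAt (fun y => ∫ ω, u y ω ∂μ) (∫ ω, fderiv ℝ (fun y => u y ω) x ∂μ) x :=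
  (hasFDerivAt_integral_of_dominated_loc_of_lip hs (Eventually.of_forall hmeas) hint
    (aestronglyMeasurable_fderiv_of_ae_differentiableAt hmeas hdiff) hlip hbound
    (hdiff.mono fun _ hω => hω.hasFDerivAt)).2

end Integral

theorem hasDerivAt_sq_max_zero (x : ℝ) :
    HasDerivAt (fun y : ℝ => max y 0 ^ 2) (2 * max x 0) x := by
  have hbound (y : ℝ) : |max y 0 ^ 2 - max x 0 ^ 2 - (y - x) * (2 * max x 0)| ≤ (y - x) ^ 2 := by
    rw [abs_le]
    rcases le_total x 0 with hx | hx <;> rcases le_total y 0 with hy | hy <;>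
      simp only [max_eq_left, max_eq_right, hx, hy] <;> constructor <;> nlinarith
  refine hasDerivAt_iff_isLittleO.2 (Asymptotics.IsBigO.trans_isLittleO
    (g := fun y => (y - x) ^ 2) (Asymptotics.IsBigO.of_bound' (Eventually.of_forall fun y => ?_))
    (by simpa using Asymptotics.isLittleO_pow_sub_sub x one_lt_two))
  simpa only [Real.norm_eq_abs, abs_sq, smul_eq_mul] using hbound y

section LatePenalty

variable {t : ℝ}

/-- In this form the differentiability of the penalty at the break points `±t` is visible. -/
theorem latePenalty_eq_sq_max_sub_sq_max (ht : 0 < t) (z : ℝ) :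
    latePenalty z t = (max (z + t) 0 ^ 2 - max (z - t) 0 ^ 2) / (4 * t) := by
  unfold latePenalty
  split_ifs with h₁ h₂
  · rw [max_eq_left (by linarith), max_eq_left (by linarith)]
    field_simp
    ring
  · rw [max_eq_left (by linarith), max_eq_right (by linarith)]
    ring
  · rw [max_eq_right (by linarith), max_eq_right (by linarith)]
    simp

theorem hasDerivAt_latePenalty (ht : 0 < t) (z : ℝ) :
    HasDerivAt (fun z => latePenalty z t)
      ((2 * max (z + t) 0 - 2 * max (z - t) 0) / (4 * t)) z := by
  simp only [latePenalty_eq_sq_max_sub_sq_max ht]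
  exact (((hasDerivAt_sq_max_zero (z + t)).comp_add_const z t).sub
    ((hasDerivAt_sq_max_zero (z - t)).comp_sub_const z t)).div_const _

theorem lipschitzWith_latePenalty (ht : 0 < t) : LipschitzWith 1 fun z => latePenalty z t := by
  refine lipschitzWith_of_nnnorm_deriv_le
    (fun z => (hasDerivAt_latePenalty ht z).differentiableAt) fun z => ?_
  have hmax : |2 * max (z + t) 0 - 2 * max (z - t) 0| ≤ 4 * t := by
    have h := abs_max_sub_max_le_abs (z + t) (z - t) 0
    rw [add_sub_sub_cancel, abs_of_pos (add_pos ht ht)] at h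
    rw [← mul_sub, abs_mul, abs_two]
    linarith
  rw [(hasDerivAt_latePenalty ht z).deriv, ← NNReal.coe_le_coe, coe_nnnorm, Real.norm_eq_abs,
    abs_div, abs_of_pos (show 0 < 4 * t by positivity), NNReal.coe_one]
  exact div_le_one_of_le₀ hmax (by positivity)

end LatePenalty

namespace MLAPUEModel

variable {Node Arc OD Path : Type*} {m : ℕ} (M : MLAPUEModel Node Arc OD Path m) {t : ℝ}

section TimeDisutility

/-- The path disutilities as a function of the vector `c` of path travel times alone; the
disutility `û` is its composition with `f ↦ C(f, ξ)`. -/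
noncomputable def timeDisutility (t : ℝ) (c : EuclideanSpace ℝ Path) : EuclideanSpace ℝ Path :=
  WithLp.toLp 2 fun r => M.θ₀ * M.attr r + M.θ₁ * c r +
    M.θ₂ * latePenalty (c r - M.τ (M.net.od r)) t

theorem differentiable_timeDisutility [Finite Path] (ht : 0 < t) :
    Differentiable ℝ (M.timeDisutility t) := by
  have := Fintype.ofFinite Path
  refine (differentiable_piLp 2).2 fun r => ?_
  have hh : Differentiable ℝ fun z => latePenalty z t :=
    fun z => (hasDerivAt_latePenalty ht z).differentiableAt
  unfold timeDisutility
  fun_prop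

theorem exists_lipschitzWith_timeDisutility [Fintype Path] (ht : 0 < t) :
    ∃ K, LipschitzWith K (M.timeDisutility t) := by
  have hcoord (r : Path) : LipschitzWith (1 * 1) fun c : EuclideanSpace ℝ Path => c r :=
    (LipschitzWith.eval r).comp (PiLp.lipschitzWith_ofLp 2 _)
  have hcomp (r : Path) := ((LipschitzWith.const (M.θ₀ * M.attr r)).add
    ((lipschitzWith_smul M.θ₁).comp (hcoord r))).add ((lipschitzWith_smul M.θ₂).comp
      ((lipschitzWith_latePenalty ht).comp ((hcoord r).sub (.const (M.τ (M.net.od r))))))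
  exact ⟨_, (PiLp.lipschitzWith_toLp 2 fun _ : Path => ℝ).comp fun c c' =>
    edist_pi_le_iff.2 fun r => hcomp r c c'⟩

end TimeDisutility

variable [Fintype Arc] [Fintype Path]

open Classical in
/-- The map `f ↦ Δ f` from path flows to arc flows, as a continuous linear map. -/
noncomputable def arcFlowCLM : EuclideanSpace ℝ Path →L[ℝ] EuclideanSpace ℝ Arc :=
  (Matrix.toLpLin 2 2 M.net.arcIncidence).toContinuousLinearMap

open Classical in
/-- The map `v ↦ Δᵀ v`, which sums the arc values along each path, as a continuous linear map. -/
noncomputable def pathSumCLM : EuclideanSpace ℝ Arc →L[ℝ] EuclideanSpace ℝ Path :=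
  (Matrix.toLpLin 2 2 M.net.arcIncidenceᵀ).toContinuousLinearMap

theorem coe_arcFlowCLM : ⇑M.arcFlowCLM = M.net.arcFlow := rfl

theorem disutility_eq_comp (t : ℝ) (ξ : EuclideanSpace ℝ (Fin m)) :
    (fun f => M.disutility t f ξ) =
      M.timeDisutility t ∘ M.pathSumCLM ∘ (fun v => M.T v ξ) ∘ M.net.arcFlow := rfl

theorem aestronglyMeasurable_disutility {P : Measure (EuclideanSpace ℝ (Fin m))} (ht : 0 < t)
    (hT : ∀ v, AEStronglyMeasurable (M.T v) P) (f : EuclideanSpace ℝ Path) :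
    AEStronglyMeasurable (M.disutility t f) P :=
  ((M.differentiable_timeDisutility ht).continuous.comp
    M.pathSumCLM.continuous).comp_aestronglyMeasurable (hT (M.net.arcFlow f))

variable {ξ : EuclideanSpace ℝ (Fin m)} {f : EuclideanSpace ℝ Path}

theorem continuousAt_disutility (ht : 0 < t)
    (hT : ContinuousAt (fun v => M.T v ξ) (M.net.arcFlow f)) :
    ContinuousAt (fun f => M.disutility t f ξ) f := by
  rw [disutility_eq_comp, ← coe_arcFlowCLM]
  exact (M.differentiable_timeDisutility ht).continuous.continuousAt.comp
    (M.pathSumCLM.continuous.continuousAt.comp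
      (ContinuousAt.comp hT M.arcFlowCLM.continuous.continuousAt))

theorem differentiableAt_disutility (ht : 0 < t)
    (hT : DifferentiableAt ℝ (fun v => M.T v ξ) (M.net.arcFlow f)) :
    DifferentiableAt ℝ (fun f => M.disutility t f ξ) f := by
  rw [disutility_eq_comp, ← coe_arcFlowCLM]
  exact (M.differentiable_timeDisutility ht _).comp f
    (M.pathSumCLM.differentiableAt.comp f
      (DifferentiableAt.comp f hT M.arcFlowCLM.differentiableAt))

theorem exists_lipschitzOnWith_disutility (ht : 0 < t) : ∃ K : NNReal,
    ∀ (ξ : EuclideanSpace ℝ (Fin m)) (L : NNReal) (𝔽 : Set (EuclideanSpace ℝ Path)),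
      LipschitzOnWith L (fun v => M.T v ξ) (M.net.arcFlow '' 𝔽) →
        LipschitzOnWith (K * L) (fun f => M.disutility t f ξ) 𝔽 := by
  obtain ⟨K, hK⟩ := M.exists_lipschitzWith_timeDisutility ht
  refine ⟨K * ‖M.pathSumCLM‖₊ * ‖M.arcFlowCLM‖₊, fun ξ L 𝔽 hL => ?_⟩
  have hcomp := hK.comp_lipschitzOnWith (M.pathSumCLM.lipschitz.comp_lipschitzOnWith
    (hL.comp (M.arcFlowCLM.lipschitz.lipschitzOnWith (s := 𝔽)) (Set.mapsTo_image _ _)))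
  rw [disutility_eq_comp]
  exact hcomp.weaken (le_of_eq (by ring))

variable {P : Measure (EuclideanSpace ℝ (Fin m))}

theorem hasFDerivAt_expDisutility (ht : 0 < t) (hTmeas : ∀ v, AEStronglyMeasurable (M.T v) P)
    (hTdiff : ∀ᵐ ξ ∂P, DifferentiableAt ℝ (fun v => M.T v ξ) (M.net.arcFlow f))
    {𝔽 : Set (EuclideanSpace ℝ Path)} (h𝔽 : 𝔽 ∈ 𝓝 f)
    {Φ : EuclideanSpace ℝ (Fin m) → ℝ} (hΦ : Integrable Φ P)
    (hTlip : ∀ᵐ ξ ∂P,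
      LipschitzOnWith (Real.nnabs (Φ ξ)) (fun v => M.T v ξ) (M.net.arcFlow '' 𝔽))
    (hint : Integrable (M.disutility t f) P) :
    HasFDerivAt (fun g => M.expDisutility t g P) (M.expJacobian t f P) f := by
  obtain ⟨K, hK⟩ := M.exists_lipschitzOnWith_disutility ht
  refine hasFDerivAt_integral_fderiv_of_lip h𝔽 (M.aestronglyMeasurable_disutility ht hTmeas) hint
    (hTlip.mono fun ξ hξ => ?_) (hΦ.const_mul (K : ℝ))
    (hTdiff.mono fun ξ hξ => M.differentiableAt_disutility ht hξ)
  rw [map_mul, Real.nnabs_coe]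
  exact hK ξ _ 𝔽 hξ

theorem expDisutility_contaminated {s : ℝ} (hs : s ∈ Set.Ioo 0 1)
    (hint : Integrable (M.disutility t f) P) :
    M.expDisutility t f (contaminated P ξ s) =
      (1 - s) • M.expDisutility t f P + s • M.disutility t f ξ := by
  unfold expDisutility contaminated
  rw [integral_add_measure (hint.smul_measure ENNReal.ofReal_ne_top)
      ((integrable_dirac (by finiteness)).smul_measure ENNReal.ofReal_ne_top),
    integral_smul_measure, integral_smul_measure, integral_dirac,
    ENNReal.toReal_ofReal (sub_pos.2 hs.2).le, ENNReal.toReal_ofReal hs.1.le]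

theorem smul_mem_equilibriumMap_of_mem_equilibria_contaminated {s : ℝ} (hs : s ∈ Set.Ioo 0 1)
    (hf : f ∈ M.equilibria t (contaminated P ξ s)) :
    s • (M.expDisutility t f P - M.disutility t f ξ) ∈ M.equilibriumMap t P f := by
  obtain ⟨hint, w, hw, h₀⟩ := hf
  have hintP : Integrable (M.disutility t f) P :=
    (integrable_smul_measure (ENNReal.ofReal_pos.2 (sub_pos.2 hs.2)).ne'
      ENNReal.ofReal_ne_top).1 hint.left_of_add_measure
  refine ⟨hintP, w, hw, ?_⟩
  rw [M.expDisutility_contaminated hs hintP] at h₀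
  rw [eq_neg_of_add_eq_zero_right h₀.symm]
  module

theorem sub_mem_protoDeriv_equilibriumMap_of_mem_GIF
    (hφ : ContinuousAt (fun g => M.expDisutility t g P) f)
    (hu : ContinuousAt (fun g => M.disutility t g ξ) f)
    {η : EuclideanSpace ℝ Path} (hη : η ∈ M.GIF t P f ξ) :
    M.expDisutility t f P - M.disutility t f ξ ∈ protoDeriv (M.equilibriumMap t P) f 0 η := by
  refine mem_protoDeriv_of_smul_residual (hφ.sub hu) ?_ hη
  filter_upwards [Ioo_mem_nhdsGT one_pos] with s hs g hg
  rw [zero_add]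
  exact M.smul_mem_equilibriumMap_of_mem_equilibria_contaminated hs hg

theorem sub_mem_protoDeriv_normalCone {J : EuclideanSpace ℝ Path →L[ℝ] EuclideanSpace ℝ Path}
    (hJ : HasFDerivAt (fun g => M.expDisutility t g P) J f) {y g : EuclideanSpace ℝ Path}
    (hy : y ∈ protoDeriv (M.equilibriumMap t P) f 0 g) :
    y - J g ∈ protoDeriv (normalCone M.D) f (-M.expDisutility t f P) g := by
  rw [← zero_sub]
  refine sub_mem_protoDeriv_of_hasFDerivAt hJ (protoDeriv_mono (fun x => ?_) hy)
  rintro _ ⟨-, w, hw, rfl⟩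
  simpa using hw

theorem isBounded_GIF {J : EuclideanSpace ℝ Path →L[ℝ] EuclideanSpace ℝ Path}
    (hJ : HasFDerivAt (fun g => M.expDisutility t g P) J f)
    (hu : ContinuousAt (fun g => M.disutility t g ξ) f)
    (hlin : {g | ∃ w ∈ protoDeriv (normalCone M.D) f (-M.expDisutility t f P) g,
      J g + w = 0} ⊆ {0}) :
    Bornology.IsBounded (M.GIF t P f ξ) := by
  have hinj : setInverse (protoDeriv (M.equilibriumMap t P) f 0) 0 ⊆ {0} := fun g hg =>
    hlin ⟨0 - J g, M.sub_mem_protoDeriv_normalCone hJ hg, add_sub_cancel _ _⟩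
  exact (isBounded_setInverse_protoDeriv hinj _).subset fun η hη =>
    M.sub_mem_protoDeriv_equilibriumMap_of_mem_GIF hJ.continuousAt hu hη

theorem normGIF_le (hf : f ∈ M.equilibria t P)
    (hφ : ContinuousAt (fun g => M.expDisutility t g P) f)
    (hu : ContinuousAt (fun g => M.disutility t g ξ) f) {γ : ℝ}
    (hγ : StronglyMetricallyRegular (M.equilibriumMap t P) f 0 γ) :
    M.normGIF t P f ξ ≤
      ENNReal.ofReal γ * ‖M.expDisutility t f P - M.disutility t f ξ‖ₑ :=
  sInf_le fun _ hη => enorm_le_of_mem_protoDeriv ENNReal.ofReal_ne_top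
    (hγ.eventually_enorm_sub_le hf) (M.sub_mem_protoDeriv_equilibriumMap_of_mem_GIF hφ hu hη)

end MLAPUEModel

theorem theorem3p1_general {Node Arc OD Path : Type*} [Fintype Arc] [Fintype Path] {m : ℕ}
    (M : MLAPUEModel Node Arc OD Path m) {t : ℝ} (ht : 0 < t)
    {P : Measure (EuclideanSpace ℝ (Fin m))}
    {f : EuclideanSpace ℝ Path} (hf : f ∈ M.equilibria t P)
    (hTmeas : ∀ v, AEStronglyMeasurable (M.T v) P)
    (hTcont : ∀ ξ, ContinuousAt (fun v => M.T v ξ) (M.net.arcFlow f))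
    (hTdiff : ∀ᵐ ξ ∂P, DifferentiableAt ℝ (fun v => M.T v ξ) (M.net.arcFlow f))
    {𝔽 : Set (EuclideanSpace ℝ Path)} (h𝔽 : 𝔽 ∈ 𝓝 f)
    {Φ : EuclideanSpace ℝ (Fin m) → ℝ} (hΦ : Integrable Φ P)
    (hTlip : ∀ᵐ ξ ∂P, ∀ v ∈ M.net.arcFlow '' 𝔽, ∀ v' ∈ M.net.arcFlow '' 𝔽,
      ‖M.T v ξ - M.T v' ξ‖ ≤ Φ ξ * ‖v - v'‖)
    (hlin : {g | ∃ w ∈ protoDeriv (normalCone M.D) f (-M.expDisutility t f P) g,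
      M.expJacobian t f P g + w = 0} ⊆ {0}) :
    (∀ ξ', Bornology.IsBounded (M.GIF t P f ξ')) ∧
    ∀ γ : ℝ, StronglyMetricallyRegular (M.equilibriumMap t P) f 0 γ → ∀ ξ',
      M.normGIF t P f ξ' ≤
        ENNReal.ofReal γ * ‖M.expDisutility t f P - M.disutility t f ξ'‖ₑ := by
  have hlip : ∀ᵐ ξ ∂P,
      LipschitzOnWith (Real.nnabs (Φ ξ)) (fun v => M.T v ξ) (M.net.arcFlow '' 𝔽) := by
    filter_upwards [hTlip] with ξ hξ
    refine LipschitzOnWith.of_dist_le_mul fun v hv v' hv' => ?_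
    rw [dist_eq_norm, dist_eq_norm, Real.coe_nnabs]
    exact (hξ v hv v' hv').trans (by gcongr; exact le_abs_self _)
  have hJ := M.hasFDerivAt_expDisutility ht hTmeas hTdiff h𝔽 hΦ hlip hf.1
  have hu ξ' := M.continuousAt_disutility ht (hTcont ξ')
  exact ⟨fun ξ' => M.isBounded_GIF hJ (hu ξ') hlin,
    fun _ hγ ξ' => M.normGIF_le hf hJ.continuousAt (hu ξ') hγ⟩

theorem theorem3p1 {Node Arc OD Path : Type*} [Fintype Arc] [Fintype Path] {m : ℕ}
    (M : MLAPUEModel Node Arc OD Path m) (t : ℝ) (ht : 0 < t)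
    -- the support and the law of the random factors
    (Ξ : Set (EuclideanSpace ℝ (Fin m))) (hΞ : IsCompact Ξ)
    (P : Measure (EuclideanSpace ℝ (Fin m))) [IsProbabilityMeasure P] (hP : P Ξᶜ = 0)
    -- a compact convex set that contains a neighbourhood of the set of equilibria
    (𝔽 : Set (EuclideanSpace ℝ Path)) (h𝔽c : IsCompact 𝔽) (h𝔽v : Convex ℝ 𝔽)
    (h𝔽 : ∃ b > 0, ∀ f ∈ M.equilibria t P, Metric.closedBall f b ⊆ 𝔽)
    -- the travel times depend measurably on the random factors and continuously on the flow
    (hTmeas : ∀ v, Measurable (M.T v))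
    (hTcont : ∀ ξ, Continuous fun v => M.T v ξ)
    -- assumptions on the travel times over the support
    (hTdiff : ∀ ξ ∈ Ξ, ContDiff ℝ 1 fun v => M.T v ξ)
    (hTbound : ∃ Φ₁ : EuclideanSpace ℝ (Fin m) → ℝ, Integrable Φ₁ P ∧
      ∀ ξ ∈ Ξ, ∀ v ∈ M.net.arcFlow '' 𝔽, ‖M.T v ξ‖ ≤ Φ₁ ξ)
    (hTlip : ∃ Φ₂ : EuclideanSpace ℝ (Fin m) → ℝ, (∀ ξ, 0 < Φ₂ ξ) ∧ Integrable Φ₂ P ∧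
      ∀ ξ ∈ Ξ, ∀ v ∈ M.net.arcFlow '' 𝔽, ∀ v' ∈ M.net.arcFlow '' 𝔽,
        ‖M.T v ξ - M.T v' ξ‖ ≤ Φ₂ ξ * ‖v - v'‖)
    -- an equilibrium, at which the linearized generalized equation has only the solution `0`
    (f : EuclideanSpace ℝ Path) (hf : f ∈ M.equilibria t P)
    (hlin : {g | ∃ w ∈ protoDeriv (normalCone M.D) f (-M.expDisutility t f P) g,
      M.expJacobian t f P g + w = 0} = {0}) :
    (∀ ξ', Bornology.IsBounded (M.GIF t P f ξ')) ∧
    ∀ γ : ℝ, StronglyMetricallyRegular (M.equilibriumMap t P) f 0 γ →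
      ⨆ ξ', M.normGIF t P f ξ' ≤
        ENNReal.ofReal γ * ⨆ g ∈ 𝔽, ⨆ ξ', ‖M.expDisutility t g P - M.disutility t g ξ'‖ₑ := by
  obtain ⟨b, hb, hball⟩ := h𝔽
  obtain ⟨Φ, -, hΦ, hlip⟩ := hTlip
  have hsupp : ∀ᵐ ξ ∂P, ξ ∈ Ξ := ae_iff.2 hP
  have h𝔽f : 𝔽 ∈ 𝓝 f := mem_of_superset (Metric.closedBall_mem_nhds f hb) (hball f hf)
  obtain ⟨hbdd, hnorm⟩ := theorem3p1_general M ht hf (fun v => (hTmeas v).aestronglyMeasurable)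
    (fun ξ => (hTcont ξ).continuousAt)
    (hsupp.mono fun ξ hξ => (hTdiff ξ hξ).differentiable one_ne_zero _) h𝔽f hΦ
    (hsupp.mono hlip) hlin.subset
  refine ⟨hbdd, fun γ hγ => iSup_le fun ξ' => (hnorm γ hγ ξ').trans ?_⟩
  gcongr
  exact le_iSup₂_of_le f (mem_of_mem_nhds h𝔽f) (le_iSup_of_le ξ' le_rfl)
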